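/- An ordered semigroup is a semigroup $S$ with a partial order $\le$ such that $s\le t$ implies $as\le at$ and $sa\le ta$ for all $a,s,t\in S$; homomorphisms of ordered semigroups are isotone semigroup homomorphisms. A pseudovariety of ordered semigroups is a class of finite ordered semigroups closed under homomorphic images, (ordered) subsemigroups and finite products. For such a class $\mathsf V$, let $\mathsf V^d$ be the class of all $(S,\cdot,\le)$ with $(S,\cdot,\ge)\in\mathsf V$; call $\mathsf V$ selfdual if $\mathsf V=\mathsf V^d$. A finite ordered semigroup is completely regular if every element lies in a subgroup. Let $\mathsf{NB}$ (normal bands) be the class of all finite ordered semigroups satisfying $x^2=x$ and $xyzx=xzyx$, and let $\mathsf{Sl}$ (semilattices) be the class of those satisfying $x^2=x$ and $xy=yx$, in both cases with arbitrary compatible partial orders. Let $U^+=\{1,\top\}$ be the ordered semigroup in which $1$ is the identity element, $\top$ is the zero, and $1<\top$; let $U^-$ be its dual, i.e. the same semigroup with the opposite order. Theorem. Let $\mathsf V$ be a pseudovariety of ordered completely regular semigroups, that is, a pseudovariety of ordered semigroups all of whose members are completely regular. Then the following conditions are equivalent: (i) $\mathsf V$ is selfdual; (ii) $\mathsf V\cap\mathsf{NB}$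 is selfdual; (iii) $\mathsf V\cap\mathsf{Sl}$ is selfdual; (iv) either both or none of the ordered semilattices $U^+$ and $U^-$ belong to $\mathsf V$. -/

import Mathlib

universe u

/-- A finite ordered semigroup: a (nonempty) finite semigroup with a stable partial order,
that is, `s ≤ t` implies `a * s ≤ a * t` and `s * a ≤ t * a`. -/
structure FinOrdSemigroup : Type (u + 1) where
  carrier : Type u
  [semigroup : Semigroup carrier]
  [partialOrder : PartialOrder carrier]
  [mulLeftMono : MulLeftMono carrier]
  [mulRightMono : MulRightMono carrier]
  [finite : Finite carrier]
  [nonempty : Nonempty carrier]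

namespace FinOrdSemigroup

instance : CoeSort FinOrdSemigroup.{u} (Type u) := ⟨FinOrdSemigroup.carrier⟩

attribute [instance] semigroup partialOrder mulLeftMono mulRightMono finite nonempty

/-- The dually ordered semigroup `(S, ·, ≥)`. -/
def dual (S : FinOrdSemigroup.{u}) : FinOrdSemigroup.{u} where
  carrier := Sᵒᵈ

/-- A nonempty subsemigroup of `S` with the induced order. -/
def sub (S : FinOrdSemigroup.{u}) (T : Subsemigroup S) (hT : (T : Set S).Nonempty) :
    FinOrdSemigroup.{u} where
  carrier := T
  mulLeftMono := ⟨fun a _ _ h => mul_le_mul_right (α := S) h (a : S)⟩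
  mulRightMono := ⟨fun a _ _ h => mul_le_mul_left (α := S) h (a : S)⟩
  nonempty := hT.to_subtype

/-- The product of finitely many ordered semigroups, with componentwise multiplication
and order. -/
def pi {n : ℕ} (S : Fin n → FinOrdSemigroup.{u}) : FinOrdSemigroup.{u} where
  carrier := ∀ i, S i
  mulLeftMono := ⟨fun a x y (h : ∀ i, x i ≤ y i) i => mul_le_mul_right (h i) (a i)⟩
  mulRightMono := ⟨fun a x y (h : ∀ i, x i ≤ y i) i => mul_le_mul_left (h i) (a i)⟩

/-- `T` is a homomorphic image of `S`: there is a surjective isotone semigroup homomorphism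
from `S` onto `T`. -/
def IsImage (T S : FinOrdSemigroup.{u}) : Prop :=
  ∃ f : S →ₙ* T, Monotone f ∧ Function.Surjective f

/-- A pseudovariety of ordered semigroups: a class of finite ordered semigroups closed under
homomorphic images, ordered subsemigroups and finite products. (Closure under isomorphism is
contained in closure under images; the empty product is the one-element semigroup.) -/
structure IsPseudovariety (V : Set FinOrdSemigroup.{u}) : Prop where
  image_mem : ∀ S ∈ V, ∀ T : FinOrdSemigroup.{u}, IsImage T S → T ∈ V
  sub_mem : ∀ S ∈ V, ∀ (T : Subsemigroup S) (hT : (T : Set S).Nonempty), S.sub T hT ∈ V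
  pi_mem : ∀ (n : ℕ) (S : Fin n → FinOrdSemigroup.{u}), (∀ i, S i ∈ V) → pi S ∈ V

/-- The class of all dually ordered semigroups: `(S, ·, ≤) ∈ dualClass V` if and only if
`(S, ·, ≥) ∈ V`. -/
def dualClass (V : Set FinOrdSemigroup.{u}) : Set FinOrdSemigroup.{u} :=
  {S | S.dual ∈ V}

/-- `V` is selfdual if it coincides with its dual. -/
def IsSelfdual (V : Set FinOrdSemigroup.{u}) : Prop :=
  V = dualClass V

/-- Ordered completely regular semigroups: there is a unary operation `x ↦ x⁻¹` with
`x x⁻¹ x = x`, `(x⁻¹)⁻¹ = x` and `x x⁻¹ = x⁻¹ x`; equivalently, every element lies in a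
subgroup. -/
def CR : Set FinOrdSemigroup.{u} :=
  {S | ∃ inv : S → S, ∀ x : S,
    x * inv x * x = x ∧ inv (inv x) = x ∧ x * inv x = inv x * x}

/-- Ordered normal bands: `x² = x` and `xyzx = xzyx`. -/
def NB : Set FinOrdSemigroup.{u} :=
  {S | (∀ x : S, x * x = x) ∧ ∀ x y z : S, x * y * z * x = x * z * y * x}

/-- Ordered semilattices: `x² = x` and `xy = yx`, with any stable partial order. -/
def Sl : Set FinOrdSemigroup.{u} :=
  {S | (∀ x : S, x * x = x) ∧ ∀ x y : S, x * y = y * x}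

/-- The two-element set `{1, ⊤}` underlying `U⁺`. -/
inductive UCarrier : Type u
  | one
  | top

namespace UCarrier

instance : Semigroup UCarrier.{u} where
  mul
    | one, y => y
    | top, _ => top
  mul_assoc a b c := by cases a <;> rfl

/-- The order with `1 < ⊤`. -/
instance : PartialOrder UCarrier.{u} where
  le x y := x = y ∨ y = top
  le_refl _ := Or.inl rfl
  le_trans := by rintro a b c (rfl | rfl) (rfl | rfl) <;> simp
  le_antisymm := by rintro a b (rfl | rfl) (h | h) <;> simp_all

instance : Finite UCarrier.{u} :=
  Finite.of_surjective (fun b : Bool => bif b then top else one) (by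
    rintro (_ | _)
    · exact ⟨false, rfl⟩
    · exact ⟨true, rfl⟩)

end UCarrier

/-- `U⁺ = {1, ⊤}`: the element `1` is the identity, `⊤` is the zero, and `1 < ⊤`. -/
def Uplus : FinOrdSemigroup.{u} where
  carrier := UCarrier.{u}
  mulLeftMono := ⟨by
    rintro (_ | _) x y h
    · exact h
    · exact le_refl UCarrier.top⟩
  mulRightMono := ⟨by
    rintro z x y (rfl | rfl)
    · exact le_refl _
    · exact Or.inr rfl⟩
  nonempty := ⟨UCarrier.one⟩

/-- `U⁻` is the dual of `U⁺`: the zero is the least element. -/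
def Uminus : FinOrdSemigroup.{u} := Uplus.dual

end FinOrdSemigroup

/-! The implications (i) ⇒ (ii) ⇒ (iii) ⇒ (iv) are formal; the content is (iv) ⇒ (i). By
`mem_of_inequalities`, the dual of S ∈ V lies in V once every inequality valid in suitable finitely
many members of V also holds reversed in S.

If U⁺ and U⁻ are in V, valid inequalities preserve content, since these semilattices detect
occurring letters. `IsRegularTheory.symm` shows that a content-preserving theory with xⁿ⁺¹ = x is
symmetric, by induction on the size of the content. From u ≤ v it derives v ≤ ut, with t over the
content of u: cutting words after their last new letter leads to words with one letter fewer,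
compared in the auxiliary theory `ContextBelow r`. The left-right dual argument gives v ≤ su, and
`le_of_le_mul` combines the two into v ≤ u.

If neither is in V, two distinct idempotents e, f with ef = fe = f would yield U⁺ or U⁻ as an image
of {e, f}. So members of V satisfy x(yx)ⁿ = x, and `symm_of_absorbing` gives symmetry without
assumptions on content. -/

namespace OrderedCR

open FreeMonoid

/-! ### Principal ideals in monoids with xⁿ⁺¹ = x. -/

section Burnside

variable {M : Type*} [Monoid M] {n : ℕ}

/-- `y` is a factor of `w`, i.e. `w` lies in the principal ideal generated by `y`. -/
def IsFactor (y w : M) : Prop := ∃ a b, w = a * y * b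

theorem IsFactor.trans {x y z : M} (hxy : IsFactor x y) (hyz : IsFactor y z) : IsFactor x z := by
  obtain ⟨a, b, rfl⟩ := hxy
  obtain ⟨c, d, rfl⟩ := hyz
  exact ⟨c * a, b * d, by simp only [mul_assoc]⟩

theorem isFactor_mul_comm (hn : n ≠ 0) (hM : ∀ x : M, x ^ (n + 1) = x) (x y : M) :
    IsFactor (x * y) (y * x) := by
  obtain ⟨m, rfl⟩ := Nat.exists_eq_succ_of_ne_zero hn
  refine ⟨y, x * (y * x) ^ m, ?_⟩
  conv_lhs => rw [← hM (y * x), pow_succ', pow_succ']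
  simp only [mul_assoc]

/-- In a completely regular monoid, the principal ideal generated by a product is the
intersection of the principal ideals generated by the factors. -/
theorem IsFactor.mul (hn : n ≠ 0) (hM : ∀ x : M, x ^ (n + 1) = x) {x y z : M}
    (hx : IsFactor x z) (hy : IsFactor y z) : IsFactor (x * y) z := by
  obtain ⟨a, b, hx⟩ := hx
  obtain ⟨c, d, hy⟩ := hy
  have h1 : IsFactor (x * (b * c * y)) (z * z) :=
    ⟨a, d, by nth_rewrite 1 [hx]; rw [hy]; simp only [mul_assoc]⟩
  have h2 : IsFactor (z * z) z := by
    obtain ⟨m, rfl⟩ := Nat.exists_eq_succ_of_ne_zero hn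
    refine ⟨1, z ^ m, ?_⟩
    conv_lhs => rw [← hM z, pow_succ', pow_succ']
    simp only [mul_assoc, one_mul]
  have h3 : IsFactor (y * x) ((b * c * y) * x) := ⟨b * c, 1, by simp only [mul_assoc, mul_one]⟩
  -- The chain of factors is xy, yx, (bcy)x, x(bcy), zz, z.
  exact ((isFactor_mul_comm hn hM x y).trans h3).trans
    ((isFactor_mul_comm hn hM _ _).trans (h1.trans h2))

theorem pow_mul_pow_self (hM : ∀ x : M, x ^ (n + 1) = x) (x : M) : x ^ n * x ^ n = x ^ n := by
  cases n with
  | zero => simp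
  | succ m =>
    rw [← pow_add, show m + 1 + (m + 1) = (m + 1 + 1) + m by ring, pow_add, hM, ← pow_succ']

/-- Since yw is again a factor of w, iterating w = (ay)wb and using that (ay)ⁿ is idempotent gives
(ay)ⁿw = w. So w is a left multiple of yw, and (yw)ⁿ is a right identity for yw. -/
theorem IsFactor.mul_pow_eq (hn : n ≠ 0) (hM : ∀ x : M, x ^ (n + 1) = x) {y w : M}
    (h : IsFactor y w) : w * (y * w) ^ n = w := by
  have hyw : IsFactor (y * w) w := h.mul hn hM ⟨1, 1, by simp⟩
  obtain ⟨a, b, hab⟩ := hyw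
  have key : ∀ k, w = (a * y) ^ k * w * b ^ k := by
    intro k
    induction k with
    | zero => simp
    | succ k ih =>
      calc w = (a * y) ^ k * w * b ^ k := ih
        _ = (a * y) ^ k * (a * (y * w) * b) * b ^ k := by rw [← hab]
        _ = _ := by rw [pow_succ, pow_succ']; simp only [mul_assoc]
  have hw : (a * y) ^ n * w = w := by
    conv_rhs => rw [key n, ← pow_mul_pow_self hM (a * y)]
    conv_lhs => rw [key n]
    simp only [mul_assoc]
  obtain ⟨m, rfl⟩ := Nat.exists_eq_succ_of_ne_zero hn
  have hg : ((a * y) ^ m * a) * (y * w) = w := by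
    conv_rhs => rw [← hw, pow_succ]
    simp only [mul_assoc]
  calc w * (y * w) ^ (m + 1) = ((a * y) ^ m * a) * (y * w) * (y * w) ^ (m + 1) := by rw [hg]
    _ = ((a * y) ^ m * a) * (y * w) ^ (m + 1 + 1) := by rw [mul_assoc, ← pow_succ']
    _ = w := by rw [hM, hg]

end Burnside

/-! ### Inequational theories on words. -/

/-- A reflexive and transitive relation on words that is compatible with multiplication and
with nonerasing substitutions. -/
structure IsInequationalTheory (r : FreeMonoid ℕ → FreeMonoid ℕ → Prop) : Prop where
  refl : ∀ u, r u u
  trans : ∀ {u v w}, r u v → r v w → r u w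
  mul_left : ∀ w {u v}, r u v → r (w * u) (w * v)
  mul_right : ∀ w {u v}, r u v → r (u * w) (v * w)
  subst : ∀ θ : ℕ → FreeMonoid ℕ, (∀ a, θ a ≠ 1) → ∀ {u v}, r u v → r (lift θ u) (lift θ v)

namespace IsInequationalTheory

variable {r : FreeMonoid ℕ → FreeMonoid ℕ → Prop}

theorem mul (h : IsInequationalTheory r) {u v u' v' : FreeMonoid ℕ} (h1 : r u v) (h2 : r u' v') :
    r (u * u') (v * v') :=
  h.trans (h.mul_right _ h1) (h.mul_left _ h2)

theorem reverse_lift (θ : ℕ → FreeMonoid ℕ) (u : FreeMonoid ℕ) :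
    (lift θ u).reverse = lift (fun a => (θ a).reverse) u.reverse := by
  induction u using FreeMonoid.inductionOn' with
  | one => rfl
  | of_mul a w ih => simp [reverse_mul, ih, reverse_of]

/-- The left-right dual of an inequational theory. -/
theorem reverse (h : IsInequationalTheory r) :
    IsInequationalTheory fun u v => r u.reverse v.reverse where
  refl u := h.refl _
  trans h1 h2 := h.trans h1 h2
  mul_left w u v h1 := by
    rw [reverse_mul, reverse_mul]; exact h.mul_right _ h1
  mul_right w u v h1 := by
    rw [reverse_mul, reverse_mul]; exact h.mul_left _ h1
  subst θ hθ u v h1 := by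
    rw [reverse_lift, reverse_lift]
    refine h.subst _ (fun a ha => hθ a ?_) h1
    rw [← reverse_reverse (a := θ a), ha]; rfl

theorem reverse_pow (u : FreeMonoid ℕ) (k : ℕ) : (u ^ k).reverse = u.reverse ^ k := by
  induction k with
  | zero => rfl
  | succ k ih => rw [pow_succ, reverse_mul, ih, pow_succ']

/-- If `u ≤ v` and `v` lies below both a right and a left multiple of `u`, then `v ≤ u`,
provided the multiplier is absorbed by `u`. -/
theorem le_of_le_mul (h : IsInequationalTheory r) {u v s t : FreeMonoid ℕ} {n : ℕ} (hn : n ≠ 0)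
    (huv : r u v) (hvt : r v (u * t)) (hvs : r v (s * u)) (hv : r v (v ^ (n + 1)))
    (habs : r (u * (t * v ^ (n - 1) * s * u) ^ n) u) : r v u := by
  -- Write vⁿ⁺¹ as v·vⁿ⁻¹·v and enlarge the first factor to ut, the last to su.
  have h1 : r v (u * (t * v ^ (n - 1) * s * u)) := by
    have h2 := h.mul (h.mul_right (v ^ (n - 1)) hvt) hvs
    have h3 : v * v ^ (n - 1) * v = v ^ (n + 1) := by
      rw [← pow_succ', Nat.sub_add_cancel (Nat.one_le_iff_ne_zero.2 hn), ← pow_succ]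
    rw [h3] at h2
    simpa only [mul_assoc] using h.trans hv h2
  generalize t * v ^ (n - 1) * s * u = y at h1 habs
  -- Since u ≤ v ≤ uy, the power of y after u may be raised until absorption applies.
  have h4 : ∀ k, r (u * y) (u * y ^ (k + 1)) := by
    intro k
    induction k with
    | zero => simpa using h.refl _
    | succ k ih =>
      refine h.trans ih ?_
      rw [pow_succ' y (k + 1), ← mul_assoc]
      exact h.mul_right _ (h.trans huv h1)
  have h5 := h4 (n - 1)
  rw [Nat.sub_add_cancel (Nat.one_le_iff_ne_zero.2 hn)] at h5
  exact h.trans h1 (h.trans h5 habs)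

end IsInequationalTheory

theorem exists_first_occurrence {a : ℕ} {u : FreeMonoid ℕ} (h : a ∈ u.symbols) :
    ∃ p s, u = p * of a * s ∧ a ∉ p.symbols := by
  rw [mem_symbols] at h
  obtain ⟨p, s, h1, h2⟩ := List.eq_append_cons_of_mem (show a ∈ toList u from h)
  refine ⟨ofList p, ofList s, ?_, fun h => h2 (mem_symbols.1 h)⟩
  rw [mul_assoc]
  exact h1

theorem exists_last_new_letter (u : FreeMonoid ℕ) (h : u ≠ 1) :
    ∃ p a s, u = p * of a * s ∧ a ∉ p.symbols ∧ s.symbols ⊆ insert a p.symbols := by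
  have key : ∀ l : List ℕ, ofList l ≠ 1 → ∃ p a s, ofList l = p * of a * s ∧ a ∉ p.symbols ∧
      s.symbols ⊆ insert a p.symbols := by
    intro l
    induction l using List.reverseRecOn with
    | nil => intro h; exact absurd rfl h
    | append_singleton l x ih =>
      intro _
      by_cases hx : x ∈ (ofList l).symbols
      · have hl : ofList l ≠ 1 := by
          intro h
          rw [h] at hx
          simp at hx
        obtain ⟨p, a, s, h1, h2, h3⟩ := ih hl
        refine ⟨p, a, s * of x, ?_, h2, ?_⟩
        · rw [ofList_append, h1, ofList_singleton]; simp only [mul_assoc]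
        · rw [h1] at hx
          simp only [symbols_mul, symbols_of, Finset.mem_union, Finset.mem_singleton] at hx ⊢
          refine Finset.union_subset h3 ?_
          rw [Finset.singleton_subset_iff]
          rcases hx with (hx | rfl) | hx
          · exact Finset.mem_insert_of_mem hx
          · exact Finset.mem_insert_self _ _
          · exact h3 hx
      · exact ⟨ofList l, x, 1, by rw [ofList_append, ofList_singleton, mul_one], hx, by simp⟩
  exact key u.toList h

/-- An inequational theory of completely regular semigroups of exponent dividing `n`, in which
both sides of each inequality have the same content. -/
structure IsRegularTheory (n : ℕ) (r : FreeMonoid ℕ → FreeMonoid ℕ → Prop) : Prop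
    extends IsInequationalTheory r where
  symbols_eq : ∀ {u v}, r u v → u.symbols = v.symbols
  pow_le : ∀ u, r (u ^ (n + 1)) u
  le_pow : ∀ u, r u (u ^ (n + 1))

theorem symbols_reverse (u : FreeMonoid ℕ) : u.reverse.symbols = u.symbols :=
  List.toFinset_reverse

theorem symbols_pow {n : ℕ} (hn : n ≠ 0) (u : FreeMonoid ℕ) : (u ^ n).symbols = u.symbols := by
  obtain ⟨m, rfl⟩ := Nat.exists_eq_succ_of_ne_zero hn
  induction m with
  | zero => simp
  | succ m ih => rw [pow_succ, symbols_mul, ih (by simp), Finset.union_self]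

theorem mem_symbols_lift {θ : ℕ → FreeMonoid ℕ} {u : FreeMonoid ℕ} {b : ℕ} :
    b ∈ (lift θ u).symbols ↔ ∃ a ∈ u.symbols, b ∈ (θ a).symbols := by
  induction u using FreeMonoid.inductionOn' with
  | one => simp
  | of_mul a w ih =>
    simp only [map_mul, lift_eval_of, symbols_mul, Finset.mem_union, symbols_of,
      Finset.mem_singleton, ih]
    aesop

theorem lift_congr {θ η : ℕ → FreeMonoid ℕ} {u : FreeMonoid ℕ}
    (h : ∀ a ∈ u.symbols, θ a = η a) : lift θ u = lift η u := by
  induction u using FreeMonoid.inductionOn' with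
  | one => rfl
  | of_mul a w ih =>
    simp only [map_mul, lift_eval_of]
    rw [h a (by simp [symbols_mul]), ih fun b hb => h b (by simp [symbols_mul, hb])]

theorem lift_eq_self {θ : ℕ → FreeMonoid ℕ} {u : FreeMonoid ℕ}
    (h : ∀ a ∈ u.symbols, θ a = of a) : lift θ u = u := by
  rw [lift_congr h]
  exact DFunLike.congr_fun (lift_restrict (MonoidHom.id (FreeMonoid ℕ))) u

namespace IsRegularTheory

variable {r : FreeMonoid ℕ → FreeMonoid ℕ → Prop} {n : ℕ}

theorem reverse (h : IsRegularTheory n r) : IsRegularTheory n fun u v => r u.reverse v.reverse where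
  toIsInequationalTheory := h.toIsInequationalTheory.reverse
  symbols_eq h1 := by simpa only [symbols_reverse] using h.symbols_eq h1
  pow_le u := by rw [IsInequationalTheory.reverse_pow]; exact h.pow_le _
  le_pow u := by rw [IsInequationalTheory.reverse_pow]; exact h.le_pow _

/-- The congruence of equality modulo the theory. -/
def con (h : IsRegularTheory n r) : Con (FreeMonoid ℕ) where
  r u v := r u v ∧ r v u
  iseqv := ⟨fun u => ⟨h.refl u, h.refl u⟩, fun h1 => ⟨h1.2, h1.1⟩,
    fun h1 h2 => ⟨h.trans h1.1 h2.1, h.trans h2.2 h1.2⟩⟩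
  mul' h1 h2 := ⟨h.mul h1.1 h2.1, h.mul h1.2 h2.2⟩

/-- In the quotient by `h.con` every letter of y is a factor of w, hence so is y by `IsFactor.mul`,
and `IsFactor.mul_pow_eq` applies. -/
theorem mul_pow_equiv (h : IsRegularTheory n r) (hn : n ≠ 0) {w y : FreeMonoid ℕ}
    (hy : y.symbols ⊆ w.symbols) : r (w * (y * w) ^ n) w ∧ r w (w * (y * w) ^ n) := by
  have hM : ∀ x : h.con.Quotient, x ^ (n + 1) = x := by
    intro x
    induction x using Con.induction_on with
    | _ x =>
      change ((x ^ (n + 1) : FreeMonoid ℕ) : h.con.Quotient) = x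
      exact (Con.eq _).2 ⟨h.pow_le x, h.le_pow x⟩
  have hf : IsFactor (y : h.con.Quotient) (w : h.con.Quotient) := by
    induction y using FreeMonoid.inductionOn' with
    | one => exact ⟨1, w, by simp⟩
    | of_mul a y ih =>
      rw [symbols_mul, symbols_of, Finset.union_subset_iff, Finset.singleton_subset_iff] at hy
      rw [Con.coe_mul]
      refine IsFactor.mul hn hM ?_ (ih hy.2)
      obtain ⟨p, s, rfl, -⟩ := exists_first_occurrence hy.1
      exact ⟨p, s, by simp⟩
  have := hf.mul_pow_eq hn hM
  exact (Con.eq _).1 (show ((w * (y * w) ^ n : FreeMonoid ℕ) : h.con.Quotient) = w from this)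

end IsRegularTheory
end OrderedCR
-- Comparison up to right multiples and the induction on content.
namespace OrderedCR

open FreeMonoid

/-- `RBelow r u v` means that, modulo `r`, the word `u` lies below an element of the right ideal
generated by `v`, with a multiplier that does not enlarge the content. -/
def RBelow (r : FreeMonoid ℕ → FreeMonoid ℕ → Prop) (u v : FreeMonoid ℕ) : Prop :=
  ∃ t, t.symbols ⊆ v.symbols ∧ r u (v * t)

/-- The relation that compares `p` and `q` through `RBelow` in every nonempty right context. -/
def ContextBelow (r : FreeMonoid ℕ → FreeMonoid ℕ → Prop) (p q : FreeMonoid ℕ) : Prop :=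
  p.symbols = q.symbols ∧ ∀ w ≠ 1, RBelow r (p * w) (q * w)

theorem symbols_lift_subset {θ : ℕ → FreeMonoid ℕ} {u : FreeMonoid ℕ} {X : Finset ℕ}
    (h : ∀ a ∈ u.symbols, (θ a).symbols ⊆ X) : (lift θ u).symbols ⊆ X := by
  intro b hb
  obtain ⟨a, ha, hab⟩ := mem_symbols_lift.1 hb
  exact h a ha hab

theorem mul_ne_one_right {u w : FreeMonoid ℕ} (hw : w ≠ 1) : u * w ≠ 1 := by
  intro h
  apply hw
  rw [← length_eq_zero] at h ⊢
  rw [length_mul] at h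
  omega

namespace IsRegularTheory

variable {r : FreeMonoid ℕ → FreeMonoid ℕ → Prop} {n : ℕ}

theorem rBelow_symbols (h : IsRegularTheory n r) {u v : FreeMonoid ℕ} (huv : RBelow r u v) :
    u.symbols = v.symbols := by
  obtain ⟨t, ht, h1⟩ := huv
  rw [h.symbols_eq h1, symbols_mul, Finset.union_eq_left.2 ht]

theorem rBelow_of_le {u v : FreeMonoid ℕ} (huv : r u v) :
    RBelow r u v :=
  ⟨1, by simp, by rwa [mul_one]⟩

theorem rBelow_trans (h : IsRegularTheory n r) {u v w : FreeMonoid ℕ} (huv : RBelow r u v)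
    (hvw : RBelow r v w) : RBelow r u w := by
  have hs := h.rBelow_symbols hvw
  obtain ⟨t, ht, h1⟩ := huv
  obtain ⟨s, hs', h2⟩ := hvw
  refine ⟨s * t, ?_, ?_⟩
  · rw [symbols_mul]
    exact Finset.union_subset hs' (hs ▸ ht)
  · rw [← mul_assoc]
    exact h.trans h1 (h.mul_right t h2)

theorem mul_rBelow (h : IsRegularTheory n r) {x s : FreeMonoid ℕ} (hs : s.symbols ⊆ x.symbols) :
    RBelow r (x * s) x :=
  ⟨s, hs, h.refl _⟩

/-- Absorption x = x(sx)ⁿ exhibits x as a right multiple of xs. With `mul_rBelow`, right factors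
over the content of x can be added or dropped freely. -/
theorem rBelow_mul (h : IsRegularTheory n r) (hn : n ≠ 0) {x s : FreeMonoid ℕ}
    (hs : s.symbols ⊆ x.symbols) : RBelow r x (x * s) := by
  obtain ⟨m, rfl⟩ := Nat.exists_eq_succ_of_ne_zero hn
  refine ⟨x * (s * x) ^ m, ?_, ?_⟩
  · intro a ha
    cases m with
    | zero => simp only [pow_zero, mul_one] at ha; simp [symbols_mul, ha]
    | succ m =>
      rw [symbols_mul, symbols_pow (Nat.succ_ne_zero m), symbols_mul] at ha
      rw [symbols_mul]
      simp only [Finset.mem_union] at ha ⊢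
      tauto
  · have := (h.mul_pow_equiv hn hs).2
    rw [pow_succ'] at this
    simpa only [mul_assoc] using this

/-- A single letter a outside the content is a universal context: substituting w for a and θ
elsewhere yields the context w. Substitutions are nonerasing, so only nonempty w arise. -/
theorem contextBelow_subst (h : IsRegularTheory n r) (θ : ℕ → FreeMonoid ℕ) (hθ : ∀ a, θ a ≠ 1)
    {p q : FreeMonoid ℕ} (hpq : ContextBelow r p q) :
    ContextBelow r (lift θ p) (lift θ q) := by
  refine ⟨?_, fun w hw => ?_⟩
  · ext b
    rw [mem_symbols_lift, mem_symbols_lift, hpq.1]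
  obtain ⟨a, ha⟩ := Infinite.exists_notMem_finset q.symbols
  obtain ⟨t, ht, h1⟩ := hpq.2 (of a) (of_ne_one a)
  set η : ℕ → FreeMonoid ℕ := Function.update θ a w with hη
  have hη1 : ∀ b, η b ≠ 1 := by
    intro b
    by_cases hb : b = a
    · subst hb; simpa [hη] using hw
    · simpa [hη, hb] using hθ b
  have hηq : ∀ u : FreeMonoid ℕ, u.symbols = q.symbols → lift η u = lift θ u := by
    intro u hu
    refine lift_congr fun b hb => ?_
    have hb' : b ≠ a := by rintro rfl; exact ha (hu ▸ hb)
    simp [hη, hb']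
  have h2 := h.subst η hη1 h1
  have ha' : η a = w := by simp [hη]
  simp only [map_mul, lift_eval_of, hηq p hpq.1, hηq q rfl, ha'] at h2
  refine ⟨lift η t, ?_, h2⟩
  rw [symbols_mul, ← hηq q rfl]
  refine symbols_lift_subset fun b hb c hc => ?_
  have hb2 := ht hb
  rw [symbols_mul, symbols_of, Finset.mem_union, Finset.mem_singleton] at hb2
  rw [Finset.mem_union]
  rcases hb2 with hb2 | rfl
  · exact Or.inl (mem_symbols_lift.2 ⟨b, hb2, hc⟩)
  · exact Or.inr (ha' ▸ hc)

theorem contextBelow_of_le (h : IsRegularTheory n r) {u v : FreeMonoid ℕ} (huv : r u v) :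
    ContextBelow r u v :=
  ⟨h.symbols_eq huv, fun w _ => rBelow_of_le (h.mul_right w huv)⟩

/-- Comparison in right contexts is again an inequational theory. -/
theorem contextBelow (h : IsRegularTheory n r) : IsRegularTheory n (ContextBelow r) where
  refl u := h.contextBelow_of_le (h.refl u)
  trans h1 h2 := ⟨h1.1.trans h2.1, fun w hw => h.rBelow_trans (h1.2 w hw) (h2.2 w hw)⟩
  mul_left m u v h1 := by
    refine ⟨by rw [symbols_mul, symbols_mul, h1.1], fun w hw => ?_⟩
    obtain ⟨t, ht, h2⟩ := h1.2 w hw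
    refine ⟨t, ht.trans ?_, ?_⟩
    · rw [mul_assoc m, symbols_mul (a := m)]
      exact Finset.subset_union_right
    · have := h.mul_left m h2
      simpa only [mul_assoc] using this
  mul_right m u v h1 := by
    refine ⟨by rw [symbols_mul, symbols_mul, h1.1], fun w hw => ?_⟩
    -- The factor m is absorbed into the context; this is why all right contexts are quantified
    -- over.
    simpa only [mul_assoc] using h1.2 (m * w) (mul_ne_one_right hw)
  subst θ hθ u v h1 := h.contextBelow_subst θ hθ h1
  symbols_eq h1 := h1.1
  pow_le u := h.contextBelow_of_le (h.pow_le u)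
  le_pow u := h.contextBelow_of_le (h.le_pow u)

/-- If `p` and `q` do not contain the letter `a`, then comparing `p a` and `q a` is the same as
comparing `p` and `q` in all right contexts. -/
theorem contextBelow_of_rBelow_mul_of (h : IsRegularTheory n r) {p q : FreeMonoid ℕ} {a : ℕ}
    (hpq : p.symbols = q.symbols) (ha : a ∉ q.symbols)
    (hab : RBelow r (p * of a) (q * of a)) : ContextBelow r p q := by
  refine ⟨hpq, fun w hw => ?_⟩
  obtain ⟨t, ht, h1⟩ := hab
  set η : ℕ → FreeMonoid ℕ := Function.update of a w with hη
  have hη1 : ∀ b, η b ≠ 1 := by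
    intro b
    by_cases hb : b = a
    · subst hb; simpa [hη] using hw
    · simp [hη, hb, of_ne_one]
  have hηb : ∀ b, b ≠ a → η b = of b := fun b hb => by simp [hη, hb]
  have hηq : ∀ u : FreeMonoid ℕ, u.symbols = q.symbols → lift η u = u := by
    intro u hu
    exact lift_eq_self fun b hb => hηb b (by rintro rfl; exact ha (hu ▸ hb))
  have h2 := h.subst η hη1 h1
  have ha' : η a = w := by simp [hη]
  simp only [map_mul, lift_eval_of, hηq p hpq, hηq q rfl, ha'] at h2
  refine ⟨lift η t, symbols_lift_subset fun b hb => ?_, h2⟩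
  have hb2 := ht hb
  rw [symbols_mul]
  by_cases hba : b = a
  · subst hba
    rw [ha']
    exact Finset.subset_union_right
  · rw [hηb b hba, symbols_of, Finset.singleton_subset_iff]
    simp only [symbols_mul, symbols_of, Finset.mem_union, Finset.mem_singleton, hba, or_false]
      at hb2
    exact Finset.mem_union_left _ hb2

/-- The substitution multiplying `a` by `x` and `b` by `y` on the left. -/
def leftMulSubst (a b : ℕ) (x y : FreeMonoid ℕ) (c : ℕ) : FreeMonoid ℕ :=
  if c = a then x * of a else if c = b then y * of b else of c

theorem leftMulSubst_ne_one (a b : ℕ) (x y : FreeMonoid ℕ) (c : ℕ) :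
    leftMulSubst a b x y c ≠ 1 := by
  unfold leftMulSubst
  split_ifs
  · exact mul_ne_one_right (of_ne_one _)
  · exact mul_ne_one_right (of_ne_one _)
  · exact of_ne_one _

theorem lift_leftMulSubst_symbols {a b : ℕ} {x y u : FreeMonoid ℕ} {X : Finset ℕ}
    (hx : x.symbols ⊆ X) (hy : y.symbols ⊆ X) (hu : u.symbols ⊆ X) :
    (lift (leftMulSubst a b x y) u).symbols ⊆ X := by
  refine symbols_lift_subset fun c hc => ?_
  have hc' := hu hc
  unfold leftMulSubst
  split_ifs with h1 h2
  · subst h1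
    rw [symbols_mul, symbols_of]
    exact Finset.union_subset hx (Finset.singleton_subset_iff.2 hc')
  · subst h2
    rw [symbols_mul, symbols_of]
    exact Finset.union_subset hy (Finset.singleton_subset_iff.2 hc')
  · simpa using hc'

/-- Applying `leftMulSubst` to an inequality `p a ⊑ q b`, where `a ∉ p` and `b ∉ q`: only the
initial segments up to the full content matter. -/
theorem rBelow_leftMulSubst (h : IsRegularTheory n r) (hn : n ≠ 0) {X : Finset ℕ}
    {u v x y u₀ v₀ u₁ v₁ : FreeMonoid ℕ} {a b : ℕ}
    (hv : v.symbols = X) (huv : RBelow r u v)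
    (hx : x.symbols ⊆ X) (hy : y.symbols ⊆ X)
    (hu₀ : lift (leftMulSubst a b x y) u = u₀ * u₁) (hu₀X : u₀.symbols = X)
    (hv₀ : lift (leftMulSubst a b x y) v = v₀ * v₁) (hv₀X : v₀.symbols = X) :
    RBelow r u₀ v₀ := by
  have huX : u.symbols = X := (h.rBelow_symbols huv).trans hv
  have h1 := lift_leftMulSubst_symbols (a := a) (b := b) hx hy huX.subset
  have h2 := lift_leftMulSubst_symbols (a := a) (b := b) hx hy hv.subset
  rw [hu₀, symbols_mul] at h1
  rw [hv₀, symbols_mul] at h2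
  obtain ⟨t, ht, h3⟩ := huv
  have h4 := h.subst (leftMulSubst a b x y) (leftMulSubst_ne_one a b x y) h3
  rw [map_mul, hu₀, hv₀, mul_assoc] at h4
  refine h.rBelow_trans (h.rBelow_mul hn (s := u₁) ?_) ⟨_, ?_, h4⟩
  · rw [hu₀X]; exact Finset.union_subset_right h1
  · rw [hv₀X, symbols_mul]
    exact Finset.union_subset (Finset.union_subset_right h2)
      (lift_leftMulSubst_symbols hx hy (hv ▸ ht))

/-- Inductive step for different last new letters. -/
theorem rBelow_symm_of_ne (h : IsRegularTheory n r) (hn : n ≠ 0) {X : Finset ℕ}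
    (hE : ∀ (p q : FreeMonoid ℕ) (a : ℕ), a ∈ X → p.symbols = X.erase a →
      q.symbols = X.erase a → RBelow r (p * of a) (q * of a) → RBelow r (q * of a) (p * of a))
    {p q : FreeMonoid ℕ} {a b : ℕ} (hab : a ≠ b) (haX : a ∈ X) (hbX : b ∈ X)
    (hp : p.symbols = X.erase a) (hq : q.symbols = X.erase b)
    (hpq : RBelow r (p * of a) (q * of b)) : RBelow r (q * of b) (p * of a) := by
  -- After b ↦ qⁿb the prefix p₁qⁿb of the image of pa already has content X, so the rest can be
  -- dropped; likewise for q₁pⁿa in the image of qb under a ↦ pⁿa.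
  obtain ⟨p₁, p₂, hp₁, hbp₁⟩ : ∃ p₁ p₂, p = p₁ * of b * p₂ ∧ b ∉ p₁.symbols :=
    exists_first_occurrence (by rw [hp]; exact Finset.mem_erase.2 ⟨hab.symm, hbX⟩)
  obtain ⟨q₁, q₂, hq₁, haq₁⟩ : ∃ q₁ q₂, q = q₁ * of a * q₂ ∧ a ∉ q₁.symbols :=
    exists_first_occurrence (by rw [hq]; exact Finset.mem_erase.2 ⟨hab, haX⟩)
  have hap : a ∉ p.symbols := by simp [hp]
  have hbq : b ∉ q.symbols := by simp [hq]
  have hp₁p : p₁.symbols ⊆ p.symbols := by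
    rw [hp₁, symbols_mul, symbols_mul, Finset.union_assoc]; exact Finset.subset_union_left
  have hq₁q : q₁.symbols ⊆ q.symbols := by
    rw [hq₁, symbols_mul, symbols_mul, Finset.union_assoc]; exact Finset.subset_union_left
  have hpn : (p ^ n).symbols = X.erase a := by rw [symbols_pow hn, hp]
  have hqn : (q ^ n).symbols = X.erase b := by rw [symbols_pow hn, hq]
  have hpnX : (p ^ n).symbols ⊆ X := hpn ▸ Finset.erase_subset _ _
  have hqnX : (q ^ n).symbols ⊆ X := hqn ▸ Finset.erase_subset _ _
  have hp₁b : p₁.symbols ⊆ X.erase b := fun c hc => Finset.mem_erase.2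
    ⟨by rintro rfl; exact hbp₁ hc, Finset.erase_subset _ _ (hp ▸ hp₁p hc)⟩
  have hq₁a : q₁.symbols ⊆ X.erase a := fun c hc => Finset.mem_erase.2
    ⟨by rintro rfl; exact haq₁ hc, Finset.erase_subset _ _ (hq ▸ hq₁q hc)⟩
  have hA : ∀ s : FreeMonoid ℕ, s.symbols = X.erase a → (s * of a).symbols = X := fun s hs => by
    rw [symbols_mul, symbols_of, hs, Finset.union_comm, ← Finset.insert_eq,
      Finset.insert_erase haX]
  have hB : ∀ s : FreeMonoid ℕ, s.symbols = X.erase b → (s * of b).symbols = X := fun s hs => by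
    rw [symbols_mul, symbols_of, hs, Finset.union_comm, ← Finset.insert_eq,
      Finset.insert_erase hbX]
  have hqp : (q₁ * p ^ n).symbols = X.erase a := by
    rw [symbols_mul, hpn, Finset.union_eq_right.2 hq₁a]
  have hpq' : (p₁ * q ^ n).symbols = X.erase b := by
    rw [symbols_mul, hqn, Finset.union_eq_right.2 hp₁b]
  have hfix : ∀ (x y s : FreeMonoid ℕ), a ∉ s.symbols → b ∉ s.symbols →
      lift (leftMulSubst a b x y) s = s := fun x y s hs1 hs2 => lift_eq_self fun c hc => by
    have h1 : c ≠ a := by rintro rfl; exact hs1 hc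
    have h2 : c ≠ b := by rintro rfl; exact hs2 hc
    simp [leftMulSubst, h1, h2]
  have hfixa : ∀ (y s : FreeMonoid ℕ), b ∉ s.symbols →
      lift (leftMulSubst a b 1 y) s = s := fun y s hs2 => lift_eq_self fun c hc => by
    have h2 : c ≠ b := by rintro rfl; exact hs2 hc
    simp +contextual [leftMulSubst, h2]
  have hfixb : ∀ (x s : FreeMonoid ℕ), a ∉ s.symbols →
      lift (leftMulSubst a b x 1) s = s := fun x s hs1 => lift_eq_self fun c hc => by
    have h1 : c ≠ a := by rintro rfl; exact hs1 hc
    simp +contextual [leftMulSubst, h1]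
  have hsa : ∀ x y, leftMulSubst a b x y a = x * of a := fun x y => by simp [leftMulSubst]
  have hsb : ∀ x y, leftMulSubst a b x y b = y * of b := fun x y => by
    simp [leftMulSubst, hab.symm]
  have hpow : ∀ s : FreeMonoid ℕ, ∀ c, RBelow r (s * s ^ n * of c) (s * of c) ∧
      RBelow r (s * of c) (s * s ^ n * of c) := fun s c => by
    rw [← pow_succ']
    exact ⟨rBelow_of_le (h.mul_right _ (h.pow_le s)), rBelow_of_le (h.mul_right _ (h.le_pow s))⟩
  have hap₁ : a ∉ p₁.symbols := fun hc => hap (hp₁p hc)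
  have hbq₁ : b ∉ q₁.symbols := fun hc => hbq (hq₁q hc)
  -- substitute `b ↦ qⁿ b`
  have h1 : RBelow r (q * of b) (p₁ * q ^ n * of b) := by
    refine hE _ _ b hbX hpq' hq ?_
    -- The image of qb is q·qⁿ·b, equivalent to qb. Both sides now end in b, so `hE` can reverse the
    -- comparison.
    refine h.rBelow_trans ?_ (hpow q b).1
    refine h.rBelow_leftMulSubst hn (hB q hq) hpq (a := a) (b := b) (x := 1) (y := q ^ n)
      (by simp) hqnX (u₁ := lift (leftMulSubst a b 1 (q ^ n)) (p₂ * of a)) (v₁ := 1) ?_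
      (hB _ hpq') ?_ ?_
    · rw [hp₁]
      simp only [map_mul, lift_eval_of, hsb, hfixa _ p₁ hbp₁, mul_assoc]
    · simp only [map_mul, lift_eval_of, hsb, hfixa _ q hbq, mul_assoc, mul_one]
    · exact hB _ (by rw [symbols_mul, hqn, hq, Finset.union_self])
  -- substitute `a ↦ pⁿ a`
  have h2 : RBelow r (q₁ * p ^ n * of a) (p * of a) := by
    refine hE _ _ a haX hp hqp ?_
    refine h.rBelow_trans (hpow p a).2 ?_
    refine h.rBelow_leftMulSubst hn (hB q hq) hpq (a := a) (b := b) (x := p ^ n) (y := 1)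
      hpnX (by simp) (u₁ := 1) (v₁ := lift (leftMulSubst a b (p ^ n) 1) (q₂ * of b)) ?_ ?_ ?_
      (hA _ hqp)
    · simp only [map_mul, lift_eval_of, hsa, hfixb _ p hap, mul_assoc, mul_one]
    · exact hA _ (by rw [symbols_mul, hpn, hp, Finset.union_self])
    · rw [hq₁]
      simp only [map_mul, lift_eval_of, hsa, hfixb _ q₁ haq₁, mul_assoc]
  -- substitute both at the same time
  refine h.rBelow_trans h1 (h.rBelow_trans ?_ h2)
  refine h.rBelow_leftMulSubst hn (hB q hq) hpq (a := a) (b := b) (x := p ^ n) (y := q ^ n)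
    hpnX hqnX (u₁ := lift (leftMulSubst a b (p ^ n) (q ^ n)) (p₂ * of a))
    (v₁ := lift (leftMulSubst a b (p ^ n) (q ^ n)) (q₂ * of b)) ?_ (hB _ hpq') ?_ (hA _ hqp)
  · generalize p ^ n = x, q ^ n = y
    rw [hp₁]
    simp only [map_mul, lift_eval_of, hsb, hfix _ _ p₁ hap₁ hbp₁, mul_assoc]
  · generalize p ^ n = x, q ^ n = y
    rw [hq₁]
    simp only [map_mul, lift_eval_of, hsa, hfix _ _ q₁ haq₁ hbq₁, mul_assoc]

/-- The relation `RBelow` is symmetric on words with `k + 1` letters if all theories are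
symmetric on words with `k` letters. -/
theorem rBelow_symm (hn : n ≠ 0) {k : ℕ}
    (ih : ∀ r, IsRegularTheory n r → ∀ u v : FreeMonoid ℕ, u.symbols.card = k → r u v → r v u)
    (h : IsRegularTheory n r) {u v : FreeMonoid ℕ} (hu : u.symbols.card = k + 1)
    (huv : RBelow r u v) : RBelow r v u := by
  have hs := h.rBelow_symbols huv
  have hne : ∀ w : FreeMonoid ℕ, w.symbols.card = k + 1 → w ≠ 1 := by
    rintro w hw rfl
    simp at hw
  obtain ⟨p, a, s, hpas, hap, hsp⟩ := exists_last_new_letter u (hne u hu)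
  obtain ⟨q, b, t, hqbt, hbq, htq⟩ := exists_last_new_letter v (hne v (hs ▸ hu))
  have hpa : (p * of a).symbols = insert a p.symbols := by
    rw [symbols_mul, symbols_of, Finset.union_comm, ← Finset.insert_eq]
  have hqb : (q * of b).symbols = insert b q.symbols := by
    rw [symbols_mul, symbols_of, Finset.union_comm, ← Finset.insert_eq]
  have huX : u.symbols = insert a p.symbols := by
    rw [hpas, symbols_mul, hpa, Finset.union_eq_left.2 hsp]
  have hvX : v.symbols = insert b q.symbols := by
    rw [hqbt, symbols_mul, hqb, Finset.union_eq_left.2 htq]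
  have h1 : RBelow r (p * of a) (q * of b) := by
    refine h.rBelow_trans (h.rBelow_mul hn (s := s) (hpa ▸ hsp)) (h.rBelow_trans (hpas ▸ huv) ?_)
    rw [hqbt]
    exact h.mul_rBelow (hqb ▸ htq)
  suffices h2 : RBelow r (q * of b) (p * of a) by
    refine h.rBelow_trans ?_ (h.rBelow_trans h2 ?_)
    · rw [hqbt]; exact h.mul_rBelow (hqb ▸ htq)
    · rw [hpas]; exact h.rBelow_mul hn (hpa ▸ hsp)
  have hE : ∀ (p q : FreeMonoid ℕ) (a : ℕ), a ∈ u.symbols → p.symbols = u.symbols.erase a →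
      q.symbols = u.symbols.erase a → RBelow r (p * of a) (q * of a) →
      RBelow r (q * of a) (p * of a) := by
    intro p q a ha hp hq hpq
    -- Removing the common last letter leaves k letters but changes the theory to `ContextBelow r`;
    -- hence the induction hypothesis ranges over all theories.
    have hc := h.contextBelow_of_rBelow_mul_of (hp.trans hq.symm) (by simp [hq]) hpq
    refine (ih _ h.contextBelow p q ?_ hc).2 _ (of_ne_one a)
    rw [hp, Finset.card_erase_of_mem ha, hu, Nat.add_sub_cancel]
  have hau : a ∈ u.symbols := by simp [huX]
  have hbu : b ∈ u.symbols := by simp [hs, hvX]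
  have hp : p.symbols = u.symbols.erase a := by rw [huX, Finset.erase_insert hap]
  have hq : q.symbols = u.symbols.erase b := by rw [hs, hvX, Finset.erase_insert hbq]
  by_cases hab : a = b
  · subst hab
    exact hE p q a hau hp hq h1
  · exact h.rBelow_symm_of_ne hn hE hab hau hbu hp hq h1

/-- An inequational theory of completely regular semigroups of finite exponent, all of whose
inequalities preserve the content, is symmetric. -/
theorem symm (hn : n ≠ 0) (h : IsRegularTheory n r) {u v : FreeMonoid ℕ} (huv : r u v) :
    r v u := by
  suffices key : ∀ k, ∀ r, IsRegularTheory n r → ∀ u v : FreeMonoid ℕ, u.symbols.card = k →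
      r u v → r v u from key _ r h u v rfl huv
  intro k
  clear huv h
  induction k with
  | zero =>
    intro r h u v hu huv
    have h1 : ∀ w : FreeMonoid ℕ, w.symbols.card = 0 → w = 1 := by
      intro w hw
      exact List.toFinset_eq_empty_iff _ |>.1 (Finset.card_eq_zero.1 hw)
    rw [h1 u hu, h1 v (h.symbols_eq huv ▸ hu)]
    exact h.refl 1
  | succ k ih =>
    intro r h u v hu huv
    have hs := h.symbols_eq huv
    obtain ⟨t, ht, hvt⟩ := rBelow_symm hn ih h hu (rBelow_of_le huv)
    obtain ⟨s, hs', hvs⟩ := rBelow_symm (u := u.reverse) (v := v.reverse) hn ih h.reverse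
      (by rw [symbols_reverse, hu])
      (rBelow_of_le (by simpa only [reverse_reverse] using huv))
    rw [reverse_mul, reverse_reverse, reverse_reverse] at hvs
    rw [symbols_reverse] at hs'
    refine h.le_of_le_mul hn huv hvt hvs (h.le_pow v) (h.mul_pow_equiv hn ?_).1
    intro c hc
    rw [symbols_mul, symbols_mul, symbols_reverse, Finset.mem_union, Finset.mem_union] at hc
    rcases hc with (hc | hc) | hc
    · exact ht hc
    -- For n = 1 the power vⁿ⁻¹ is the empty word.
    · by_cases hn1 : n - 1 = 0
      · simp [hn1] at hc
      · rw [symbols_pow hn1] at hc; exact hs ▸ hc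
    · exact hs' hc

end IsRegularTheory

/-! ### Absorbing theories: the completely simple case. -/

theorem IsInequationalTheory.exists_le_mul {r : FreeMonoid ℕ → FreeMonoid ℕ → Prop} {n : ℕ}
    (hn : n ≠ 0) (h : IsInequationalTheory r)
    (habs : ∀ x y : FreeMonoid ℕ, x ≠ 1 → r x (x * (y * x) ^ n)) {u v : FreeMonoid ℕ} (hu : u ≠ 1)
    (hv : v ≠ 1) (huv : r u v) : ∃ t, r v (u * t) := by
  obtain ⟨m, rfl⟩ := Nat.exists_eq_succ_of_ne_zero hn
  cases u using FreeMonoid.casesOn with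
  | one => exact absurd rfl hu
  | of_mul a u =>
  cases v using FreeMonoid.casesOn with
  | one => exact absurd rfl hv
  | of_mul b v =>
  have hx : ∀ (c : ℕ) (w : FreeMonoid ℕ), ∃ t, r (of c) (of c * w * t) := fun c w =>
    ⟨of c * (w * of c) ^ m, by simpa only [pow_succ', mul_assoc] using habs (of c) w (of_ne_one c)⟩
  obtain ⟨t₁, ht₁⟩ := hx a u
  have h1 : r (of a) (of b * (v * t₁)) := by
    simpa only [mul_assoc] using h.trans ht₁ (h.mul_right t₁ huv)
  -- From a ≤ ut₁ ≤ vt₁ = b⋯, exchanging the first letters a and b gives b ≤ as. Then v ≤ as⋯, and a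
  -- ≤ ut₁ turns this into a right multiple of u.
  have h2 := h.subst (fun c => of (Equiv.swap a b c)) (fun c => of_ne_one _) h1
  simp only [map_mul, lift_eval_of, Equiv.swap_apply_left, Equiv.swap_apply_right] at h2
  generalize (lift fun c => of (Equiv.swap a b c)) v *
    (lift fun c => of (Equiv.swap a b c)) t₁ = s at h2
  refine ⟨t₁ * (s * v), h.trans (h.mul_right v h2) ?_⟩
  simpa only [mul_assoc] using h.mul_right (s * v) ht₁

/-- An inequational theory in which every nonempty word is absorbing, i.e. a theory of completely
simple semigroups, is symmetric on nonempty words. -/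
theorem IsInequationalTheory.symm_of_absorbing {r : FreeMonoid ℕ → FreeMonoid ℕ → Prop} {n : ℕ}
    (hn : n ≠ 0) (h : IsInequationalTheory r)
    (habs : ∀ x y : FreeMonoid ℕ, x ≠ 1 → r x (x * (y * x) ^ n) ∧ r (x * (y * x) ^ n) x)
    {u v : FreeMonoid ℕ} (hu : u ≠ 1) (hv : v ≠ 1) (huv : r u v) : r v u := by
  have hrev : ∀ w : FreeMonoid ℕ, w ≠ 1 → w.reverse ≠ 1 := fun w hw h1 => hw (by
    rw [← reverse_reverse (a := w), h1]; rfl)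
  -- This identity makes the absorption hypothesis left-right symmetric.
  have hpow : ∀ x y : FreeMonoid ℕ, ∀ k, x * (y * x) ^ k = (x * y) ^ k * x := by
    intro x y k
    induction k with
    | zero => simp
    | succ k ih => rw [pow_succ, ← mul_assoc, ih, pow_succ]; simp only [mul_assoc]
  obtain ⟨t, hvt⟩ := h.exists_le_mul hn (fun x y hx => (habs x y hx).1) hu hv huv
  obtain ⟨s, hvs⟩ := h.reverse.exists_le_mul (u := u.reverse) (v := v.reverse) hn
    (fun x y hx => by
      rw [reverse_mul, IsInequationalTheory.reverse_pow, reverse_mul, ← hpow]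
      exact (habs _ _ (hrev x hx)).1) (hrev u hu) (hrev v hv)
    (by simpa only [reverse_reverse] using huv)
  rw [reverse_mul, reverse_reverse, reverse_reverse] at hvs
  refine h.le_of_le_mul hn huv hvt hvs ?_ (habs u _ hu).2
  simpa only [one_mul, ← pow_succ'] using (habs v 1 hv).1

end OrderedCR
-- The theory of inequalities of an ordered semigroup.
namespace OrderedCR

open FreeMonoid FinOrdSemigroup

section Evaluation

variable {S : Type*} [Semigroup S]

/-- The value of a word in `S` with an external identity adjoined. -/
def eval (σ : ℕ → S) : FreeMonoid ℕ →* WithOne S := lift fun a => (σ a : WithOne S)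

theorem eval_of (σ : ℕ → S) (a : ℕ) : eval σ (of a) = σ a := rfl

theorem exists_eval_eq_coe (σ : ℕ → S) {u : FreeMonoid ℕ} (hu : u ≠ 1) :
    ∃ s : S, eval σ u = s := by
  induction u using FreeMonoid.inductionOn' with
  | one => exact absurd rfl hu
  | of_mul a w ih =>
    by_cases hw : w = 1
    · exact ⟨σ a, by rw [hw, mul_one, eval_of]⟩
    · obtain ⟨s, hs⟩ := ih hw
      exact ⟨σ a * s, by rw [map_mul, hs, eval_of, WithOne.coe_mul]⟩

end Evaluation

section Order

variable {S : Type*} [PartialOrder S]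

/-- The order of `S`, extended to `WithOne S` so that `1` is only comparable with itself. -/
def WithOneLE (x y : WithOne S) : Prop :=
  x = 1 ∧ y = 1 ∨ ∃ a b : S, x = a ∧ y = b ∧ a ≤ b

theorem withOneLE_refl (x : WithOne S) : WithOneLE x x := by
  cases x using WithOne.recOneCoe with
  | one => exact Or.inl ⟨rfl, rfl⟩
  | coe a => exact Or.inr ⟨a, a, rfl, rfl, le_rfl⟩

theorem withOneLE_coe {a b : S} : WithOneLE (a : WithOne S) b ↔ a ≤ b := by
  refine ⟨?_, fun h => Or.inr ⟨a, b, rfl, rfl, h⟩⟩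
  rintro (⟨h, -⟩ | ⟨c, d, h1, h2, h⟩)
  · exact absurd h WithOne.coe_ne_one
  · rwa [WithOne.coe_inj.1 h1, WithOne.coe_inj.1 h2]

theorem withOneLE_trans {x y z : WithOne S} (hxy : WithOneLE x y) (hyz : WithOneLE y z) :
    WithOneLE x z := by
  rcases hxy with ⟨rfl, rfl⟩ | ⟨a, b, rfl, rfl, hab⟩
  · exact hyz
  · rcases hyz with ⟨h, -⟩ | ⟨c, d, h1, rfl, hcd⟩
    · exact absurd h WithOne.coe_ne_one
    · rw [WithOne.coe_inj] at h1
      exact Or.inr ⟨a, d, rfl, rfl, hab.trans (h1 ▸ hcd)⟩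

variable [Semigroup S]

theorem withOneLE_mul_left [MulLeftMono S] (z : WithOne S) {x y : WithOne S}
    (h : WithOneLE x y) : WithOneLE (z * x) (z * y) := by
  rcases h with ⟨rfl, rfl⟩ | ⟨a, b, rfl, rfl, hab⟩
  · exact withOneLE_refl _
  · cases z using WithOne.recOneCoe with
    | one => simpa only [one_mul, withOneLE_coe] using hab
    | coe c =>
      rw [← WithOne.coe_mul, ← WithOne.coe_mul, withOneLE_coe]
      exact mul_le_mul_right hab c

theorem withOneLE_mul_right [MulRightMono S] (z : WithOne S) {x y : WithOne S}
    (h : WithOneLE x y) : WithOneLE (x * z) (y * z) := by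
  rcases h with ⟨rfl, rfl⟩ | ⟨a, b, rfl, rfl, hab⟩
  · exact withOneLE_refl _
  · cases z using WithOne.recOneCoe with
    | one => simpa only [mul_one, withOneLE_coe] using hab
    | coe c =>
      rw [← WithOne.coe_mul, ← WithOne.coe_mul, withOneLE_coe]
      exact mul_le_mul_left hab c

variable (S) in
/-- The inequality `u ≤ v` holds in `S`. -/
def Holds (u v : FreeMonoid ℕ) : Prop :=
  ∀ σ : ℕ → S, WithOneLE (eval σ u) (eval σ v)

variable (S) in
theorem isInequationalTheory_holds [MulLeftMono S] [MulRightMono S] :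
    IsInequationalTheory (Holds S) where
  refl u σ := withOneLE_refl _
  trans h1 h2 σ := withOneLE_trans (h1 σ) (h2 σ)
  mul_left w u v h σ := by
    rw [map_mul, map_mul]
    exact withOneLE_mul_left _ (h σ)
  mul_right w u v h σ := by
    rw [map_mul, map_mul]
    exact withOneLE_mul_right _ (h σ)
  subst θ hθ u v h σ := by
    -- Nonerasing substitutions send letters to words with values in S itself, so τ is again an
    -- assignment.
    choose τ hτ using fun a => exists_eval_eq_coe σ (hθ a)
    have key : ∀ w, eval σ (lift θ w) = eval τ w := by
      intro w
      rw [hom_map_lift]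
      exact DFunLike.congr_fun (congrArg lift (funext hτ)) w
    rw [key, key]
    exact h τ

-- Equal content is imposed here, as inequalities of S need not preserve it; U⁺ and U⁻ will supply
-- it.
variable (S) in
theorem isRegularTheory_holds [MulLeftMono S] [MulRightMono S] {n : ℕ}
    (hS : ∀ x : WithOne S, x ^ (n + 1) = x) :
    IsRegularTheory n fun u v => u.symbols = v.symbols ∧ Holds S u v where
  refl u := ⟨rfl, (isInequationalTheory_holds S).refl u⟩
  trans h1 h2 := ⟨h1.1.trans h2.1, (isInequationalTheory_holds S).trans h1.2 h2.2⟩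
  mul_left w u v h := ⟨by rw [symbols_mul, symbols_mul, h.1],
    (isInequationalTheory_holds S).mul_left w h.2⟩
  mul_right w u v h := ⟨by rw [symbols_mul, symbols_mul, h.1],
    (isInequationalTheory_holds S).mul_right w h.2⟩
  subst θ hθ u v h := ⟨by ext b; rw [mem_symbols_lift, mem_symbols_lift, h.1],
    (isInequationalTheory_holds S).subst θ hθ h.2⟩
  symbols_eq h := h.1
  pow_le u := ⟨symbols_pow n.succ_ne_zero u, fun σ => by
    rw [map_pow, hS]; exact withOneLE_refl _⟩
  le_pow u := ⟨(symbols_pow n.succ_ne_zero u).symm, fun σ => by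
    rw [map_pow, hS]; exact withOneLE_refl _⟩

end Order

/-! ### Coding words over S, and detecting content in {1, ⊤}. -/

section Embedding

/-- Words over `S` as words over `ℕ`, along a coding of letters. -/
def encode {S : Type*} (f : S → ℕ) : FreeSemigroup S →ₙ* FreeMonoid ℕ :=
  FreeSemigroup.lift fun s => of (f s)

theorem encode_of {S : Type*} (f : S → ℕ) (s : S) : encode f (FreeSemigroup.of s) = of (f s) := rfl

theorem encode_ne_one {S : Type*} (f : S → ℕ) (u : FreeSemigroup S) : encode f u ≠ 1 := by
  induction u using FreeSemigroup.recOnMul with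
  | ih1 s => exact of_ne_one _
  | ih2 s u _ hu => rw [map_mul]; exact mul_ne_one_right hu

theorem eval_encode {S T : Type*} [Semigroup T] (f : S → ℕ) (σ : ℕ → T) (u : FreeSemigroup S) :
    eval σ (encode f u) = (FreeSemigroup.lift (σ ∘ f) u : T) := by
  induction u using FreeSemigroup.recOnMul with
  | ih1 s => rfl
  | ih2 s u hs hu => rw [map_mul, map_mul, hs, hu, map_mul, WithOne.coe_mul]

open Classical in
/-- The assignment of values in `{1, ⊤}` that detects occurrences of the letter `s₀`. -/
noncomputable def detect {S : Type*} (s₀ s : S) : UCarrier.{u} :=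
  if s = s₀ then UCarrier.top else UCarrier.one

theorem UCarrier.mul_eq_top {x y : UCarrier.{u}} :
    x * y = UCarrier.top ↔ x = UCarrier.top ∨ y = UCarrier.top := by
  cases x
  · exact ⟨Or.inr, fun h => h.resolve_left (by simp)⟩
  · exact ⟨fun _ => Or.inl rfl, fun _ => rfl⟩

theorem lift_detect_eq_top {S : Type*} {f : S → ℕ} (hf : Function.Injective f) (s₀ : S)
    (u : FreeSemigroup S) :
    FreeSemigroup.lift (detect.{u} s₀) u = UCarrier.top ↔ f s₀ ∈ (encode f u).symbols := by
  induction u using FreeSemigroup.recOnMul with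
  | ih1 s =>
    rw [encode_of, symbols_of, Finset.mem_singleton, hf.eq_iff]
    change detect s₀ s = _ ↔ _
    unfold detect
    split_ifs with h
    · simp [h]
    · simp [Ne.symm h]
  | ih2 s u hs hu =>
    rw [map_mul, map_mul, symbols_mul, Finset.mem_union, UCarrier.mul_eq_top, hs, hu]

theorem exists_of_mem_symbols_encode {S : Type*} {f : S → ℕ} {u : FreeSemigroup S} {b : ℕ}
    (hb : b ∈ (encode f u).symbols) : ∃ s, f s = b := by
  induction u using FreeSemigroup.recOnMul with
  | ih1 s =>
    rw [encode_of, symbols_of, Finset.mem_singleton] at hb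
    exact ⟨s, hb.symm⟩
  | ih2 s u hs hu =>
    rw [map_mul, symbols_mul, Finset.mem_union] at hb
    exact hb.elim hs hu

theorem symbols_encode_subset {S : Type*} {f : S → ℕ} (hf : Function.Injective f)
    {u v : FreeSemigroup S}
    (h : ∀ s₀, FreeSemigroup.lift (detect.{u} s₀) u = UCarrier.top →
      FreeSemigroup.lift (detect.{u} s₀) v = UCarrier.top) :
    (encode f u).symbols ⊆ (encode f v).symbols := by
  intro b hb
  obtain ⟨s, rfl⟩ := exists_of_mem_symbols_encode hb
  rw [← lift_detect_eq_top.{u} hf] at hb ⊢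
  exact h s hb

end Embedding

/-! ### Membership in a pseudovariety and closure under dualizing. -/

section Pseudovariety

variable {V : Set FinOrdSemigroup.{u}}

/-- A finite ordered semigroup that satisfies all inequalities valid for given assignments into
finitely many members of a pseudovariety belongs to it. -/
theorem mem_of_inequalities (hV : IsPseudovariety V) {J A : Type u} [Finite J]
    (fac : J → FinOrdSemigroup.{u}) (hfac : ∀ j, fac j ∈ V) (gen : ∀ j, A → fac j)
    (T : FinOrdSemigroup.{u}) (τ : A → T) (hτ : Function.Surjective τ)
    (h : ∀ u v : FreeSemigroup A,
      (∀ j, FreeSemigroup.lift (gen j) u ≤ FreeSemigroup.lift (gen j) v) →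
      FreeSemigroup.lift τ u ≤ FreeSemigroup.lift τ v) : T ∈ V := by
  obtain ⟨m, ⟨e⟩⟩ := Finite.exists_equiv_fin J
  let P : FinOrdSemigroup.{u} := FinOrdSemigroup.pi fun i => fac (e.symm i)
  have hP : P ∈ V := hV.pi_mem m _ fun i => hfac _
  let Φ : FreeSemigroup A →ₙ* P := FreeSemigroup.lift fun a => (fun i => gen (e.symm i) a)
  have hΦ : ∀ u i, Φ u i = FreeSemigroup.lift (gen (e.symm i)) u := by
    intro u i
    induction u using FreeSemigroup.recOnMul with
    | ih1 a => rfl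
    | ih2 a u ha hu =>
      rw [map_mul, map_mul, ← ha, ← hu]
      rfl
  have hle : ∀ u v, Φ u ≤ Φ v → FreeSemigroup.lift τ u ≤ FreeSemigroup.lift τ v := by
    intro u v huv
    refine h u v fun j => ?_
    obtain ⟨i, rfl⟩ := e.symm.surjective j
    have h1 : Φ u i ≤ Φ v i := huv i
    rw [hΦ, hΦ] at h1
    exact h1
  have hne : (Φ.srange : Set P).Nonempty :=
    ⟨_, FreeSemigroup.of (hτ T.nonempty.some).choose, rfl⟩
  refine hV.image_mem _ (hV.sub_mem P hP Φ.srange hne) T ?_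
  choose w hw using fun x : Φ.srange => MulHom.mem_srange.1 x.2
  -- Antisymmetry in T makes the value independent of the chosen word.
  have hwu : ∀ x : Φ.srange, ∀ u, Φ u = x → FreeSemigroup.lift τ (w x) = FreeSemigroup.lift τ u :=
    fun x u hu => le_antisymm (hle _ _ (by rw [hw, hu])) (hle _ _ (by rw [hw, hu]))
  refine ⟨⟨fun x => FreeSemigroup.lift τ (w x), fun x y => ?_⟩, fun x y hxy => ?_, fun t => ?_⟩
  · rw [← map_mul]
    exact hwu _ _ ((map_mul Φ _ _).trans (congrArg₂ (· * ·) (hw x) (hw y)))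
  · exact hle _ _ (((hw x).le.trans (show (x.1 : P) ≤ y.1 from hxy)).trans (hw y).ge)
  · obtain ⟨a, rfl⟩ := hτ t
    exact ⟨⟨Φ (FreeSemigroup.of a), FreeSemigroup.of a, rfl⟩, hwu _ (FreeSemigroup.of a) rfl⟩

/-- By finiteness two power maps xⁱ and xʲ with i < j coincide; the commuting inverse then cancels
down to x = x^(j-i+1). -/
theorem exists_pow_succ_eq {S : FinOrdSemigroup.{u}} (hS : S ∈ CR) :
    ∃ n : ℕ, n ≠ 0 ∧ ∀ x : WithOne S, x ^ (n + 1) = x := by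
  have : Finite (WithOne S) := inferInstanceAs (Finite (Option S))
  obtain ⟨i, j, hij, h⟩ : ∃ i j : ℕ, i < j ∧ ∀ x : WithOne S, x ^ i = x ^ j := by
    obtain ⟨i, j, hij, h⟩ :=
      Finite.exists_ne_map_eq_of_infinite fun (k : ℕ) (x : WithOne S) => x ^ k
    rcases lt_or_gt_of_ne hij with hij | hij
    · exact ⟨i, j, hij, congrFun h⟩
    · exact ⟨j, i, hij, congrFun h.symm⟩
  obtain ⟨d, rfl⟩ := Nat.exists_eq_add_of_lt hij
  refine ⟨d + 1, by simp, fun x => ?_⟩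
  obtain ⟨inv, hinv⟩ := hS
  cases x using WithOne.recOneCoe with
  | one => simp
  | coe a =>
    obtain ⟨h1, -, h2⟩ := hinv a
    generalize inv a = b at h1 h2
    have h1' : (a : WithOne S) * b * a = a := by rw [← WithOne.coe_mul, ← WithOne.coe_mul, h1]
    have h2' : Commute (a : WithOne S) b := by
      change (a : WithOne S) * b = b * a
      rw [← WithOne.coe_mul, h2, WithOne.coe_mul]
    generalize (a : WithOne S) = x at h1' h2'
    generalize (b : WithOne S) = y at h1' h2'
    have key : ∀ k, x ^ (k + 1) * y ^ k = x := by
      intro k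
      induction k with
      | zero => simp
      | succ k ih =>
        calc x ^ (k + 1 + 1) * y ^ (k + 1) = x * (x ^ (k + 1) * y ^ k) * y := by
              rw [pow_succ', pow_succ y]; simp only [mul_assoc]
          _ = x := by rw [ih, mul_assoc, h2'.eq, ← mul_assoc, h1']
    calc x ^ (d + 1 + 1) = x ^ (d + 1) * (x ^ (i + 1) * y ^ i) := by rw [key, ← pow_succ]
      _ = x * x ^ (i + d + 1) * y ^ i := by
        rw [← mul_assoc, ← pow_add, ← pow_succ']; congr 2; omega
      _ = x := by rw [← h, ← pow_succ', key]

/-- If `U⁺` and `U⁻` belong to `V`, then `V` is closed under dualizing. -/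
theorem dual_mem_of_mem (hV : IsPseudovariety V) (hCR : V ⊆ CR) (hp : Uplus.{u} ∈ V)
    (hm : Uminus.{u} ∈ V) {S : FinOrdSemigroup.{u}} (hS : S ∈ V) : S.dual ∈ V := by
  obtain ⟨n, hn, hpow⟩ := exists_pow_succ_eq (hCR hS)
  obtain ⟨f, hf⟩ := Countable.exists_injective_nat S
  -- All assignments S → S are used, so that the inequality holds in S identically; each letter s
  -- adds one copy of U⁺ and one of U⁻ that test for s.
  refine mem_of_inequalities hV (J := (S → S) ⊕ (S ⊕ S)) (A := S)
    (Sum.elim (fun _ => S) (Sum.elim (fun _ => Uplus) fun _ => Uminus))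
    (by rintro (σ | s | s) <;> assumption)
    (fun j => match j with
      | .inl σ => σ
      | .inr (.inl s) => detect s
      | .inr (.inr s) => detect s)
    S.dual (fun s => s) (fun s => ⟨s, rfl⟩) ?_
  intro u v huv
  have hsymb : (encode f u).symbols = (encode f v).symbols := by
    apply Finset.Subset.antisymm
    · refine symbols_encode_subset.{u} hf fun s₀ h => ?_
      rcases huv (.inr (.inl s₀)) with h1 | h1
      · exact h1.symm.trans h
      · exact h1
    · refine symbols_encode_subset.{u} hf fun s₀ h => ?_
      rcases huv (.inr (.inr s₀)) with h1 | h1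
      · exact h1.symm.trans h
      · exact h1
  have hholds : Holds S (encode f u) (encode f v) := fun σ => by
    rw [eval_encode, eval_encode, withOneLE_coe]
    exact huv (.inl (σ ∘ f))
  -- The reversed inequality is evaluated at the assignment that decodes letters back to elements of
  -- S.
  have h := ((isRegularTheory_holds S hpow).symm hn ⟨hsymb, hholds⟩).2 (Function.invFun f)
  rw [eval_encode, eval_encode, withOneLE_coe, Function.invFun_comp hf] at h
  exact h

/-! ### Two-element chains of idempotents as sources of U⁺ and U⁻. -/

section Chain

variable {S : FinOrdSemigroup.{u}} {e f : S}

/-- The subsemigroup consisting of an idempotent `e` and an idempotent `f` below it. -/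
def chain (hee : e * e = e) (hff : f * f = f) (hef : e * f = f) (hfe : f * e = f) :
    Subsemigroup S where
  carrier := {e, f}
  mul_mem' := by
    rintro a b (rfl | rfl) (rfl | rfl)
    · exact Or.inl hee
    · exact Or.inr hef
    · exact Or.inr hfe
    · exact Or.inr hff

open Classical in
/-- The homomorphism from `{e, f}` to `{1, ⊤}` mapping `e` to `1` and `f` to `⊤`. -/
noncomputable def chainHom (hee : e * e = e) (hff : f * f = f) (hef : e * f = f)
    (hfe : f * e = f) (hne : e ≠ f) : chain hee hff hef hfe →ₙ* UCarrier.{u} where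
  toFun x := if (x : S) = e then UCarrier.one else UCarrier.top
  map_mul' := by
    rintro ⟨a, ha⟩ ⟨b, hb⟩
    change (if a * b = e then UCarrier.one else UCarrier.top) =
      (if a = e then UCarrier.one else UCarrier.top) *
        (if b = e then UCarrier.one else UCarrier.top)
    rcases (ha : a = e ∨ a = f) with rfl | rfl <;> rcases (hb : b = _ ∨ b = _) with rfl | rfl <;>
      simp only [hee, hff, hef, hfe, if_true, if_neg hne.symm] <;> rfl

theorem chainHom_surjective (hee : e * e = e) (hff : f * f = f) (hef : e * f = f)
    (hfe : f * e = f) (hne : e ≠ f) :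
    Function.Surjective (chainHom hee hff hef hfe hne) := by
  rintro (_ | _)
  · exact ⟨⟨e, Or.inl rfl⟩, if_pos rfl⟩
  · exact ⟨⟨f, Or.inr rfl⟩, if_neg hne.symm⟩

/-- The map e ↦ 1, f ↦ ⊤ is isotone into U⁺ unless f ≤ e; e and f may be incomparable. -/
theorem uplus_mem_of_not_le (hV : IsPseudovariety V) (hS : S ∈ V) (hee : e * e = e)
    (hff : f * f = f) (hef : e * f = f) (hfe : f * e = f) (h : ¬ f ≤ e) : Uplus.{u} ∈ V := by
  have hne : e ≠ f := fun h' => h h'.ge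
  refine hV.image_mem _ (hV.sub_mem S hS (chain hee hff hef hfe) ⟨e, Or.inl rfl⟩) Uplus
    ⟨chainHom hee hff hef hfe hne, ?_, chainHom_surjective hee hff hef hfe hne⟩
  rintro ⟨a, rfl | rfl⟩ ⟨b, rfl | rfl⟩ hab
  · exact Or.inl rfl
  · exact Or.inr (if_neg hne.symm)
  · exact absurd hab h
  · exact Or.inl rfl

theorem uminus_mem_of_not_le (hV : IsPseudovariety V) (hS : S ∈ V) (hee : e * e = e)
    (hff : f * f = f) (hef : e * f = f) (hfe : f * e = f) (h : ¬ e ≤ f) : Uminus.{u} ∈ V := by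
  have hne : e ≠ f := fun h' => h h'.le
  refine hV.image_mem _ (hV.sub_mem S hS (chain hee hff hef hfe) ⟨e, Or.inl rfl⟩) Uminus
    ⟨chainHom hee hff hef hfe hne, ?_, chainHom_surjective hee hff hef hfe hne⟩
  rintro ⟨a, rfl | rfl⟩ ⟨b, rfl | rfl⟩ hab
  · exact Or.inl rfl
  · exact absurd hab h
  · exact Or.inr (if_neg hne.symm)
  · exact Or.inl rfl

end Chain

/-- If neither `U⁺` nor `U⁻` belongs to `V`, then the members of `V` are completely simple. -/
theorem mul_pow_eq_of_notMem (hV : IsPseudovariety V) (hp : Uplus.{u} ∉ V) (hm : Uminus.{u} ∉ V)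
    {S : FinOrdSemigroup.{u}} (hS : S ∈ V) {n : ℕ} (hn : n ≠ 0)
    (hpow : ∀ x : WithOne S, x ^ (n + 1) = x) (x y : WithOne S) (hx : x ≠ 1) :
    x * (y * x) ^ n = x := by
  have hne : ∀ z w : WithOne S, w ≠ 1 → z * w ≠ 1 := by
    intro z w hw
    obtain ⟨b, rfl⟩ := WithOne.ne_one_iff_exists.1 hw
    cases z using WithOne.recOneCoe with
    | one => rwa [one_mul]
    | coe a => exact WithOne.coe_ne_one
  have hnp : ∀ z : WithOne S, z ≠ 1 → z ^ n ≠ 1 := by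
    intro z hz
    obtain ⟨m, rfl⟩ := Nat.exists_eq_succ_of_ne_zero hn
    rw [pow_succ]
    exact hne _ _ hz
  have hx1 := hnp x hx
  have hxn := pow_mul_pow_self hpow x
  have hf1 := hnp (x ^ n * y * x ^ n) (hne _ _ hx1)
  have hff := pow_mul_pow_self hpow (x ^ n * y * x ^ n)
  have hef : x ^ n * (x ^ n * y * x ^ n) ^ n = (x ^ n * y * x ^ n) ^ n := by
    have h : x ^ n * (x ^ n * y * x ^ n) = x ^ n * y * x ^ n := by
      rw [← mul_assoc, ← mul_assoc, hxn]
    generalize x ^ n * y * x ^ n = g, x ^ n = e at h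
    obtain ⟨m, rfl⟩ := Nat.exists_eq_succ_of_ne_zero hn
    rw [pow_succ', ← mul_assoc, h]
  have hfe : (x ^ n * y * x ^ n) ^ n * x ^ n = (x ^ n * y * x ^ n) ^ n := by
    have h : x ^ n * y * x ^ n * x ^ n = x ^ n * y * x ^ n := by
      rw [mul_assoc, hxn]
    generalize x ^ n * y * x ^ n = g, x ^ n = e at h
    obtain ⟨m, rfl⟩ := Nat.exists_eq_succ_of_ne_zero hn
    rw [pow_succ, mul_assoc, h]
  -- The idempotents xⁿ and (xⁿyxⁿ)ⁿ form a chain; were they distinct, one of the two order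
  -- relations would fail and put U⁺ or U⁻ in V.
  have heq : x ^ n = (x ^ n * y * x ^ n) ^ n := by
    obtain ⟨e, he⟩ := WithOne.ne_one_iff_exists.1 hx1
    obtain ⟨f, hf⟩ := WithOne.ne_one_iff_exists.1 hf1
    rw [← hf] at hff hef hfe ⊢
    rw [← he] at hxn hef hfe ⊢
    rw [← WithOne.coe_mul, WithOne.coe_inj] at hff hef hfe hxn
    rw [WithOne.coe_inj]
    by_contra hne'
    by_cases h : e ≤ f
    · exact hp (uplus_mem_of_not_le hV hS hxn hff hef hfe fun h' => hne' (le_antisymm h h'))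
    · exact hm (uminus_mem_of_not_le hV hS hxn hff hef hfe h)
  -- By `heq`, y is a factor of xⁿ, hence of x = x·xⁿ.
  refine IsFactor.mul_pow_eq hn hpow ?_
  obtain ⟨m, rfl⟩ := Nat.exists_eq_succ_of_ne_zero hn
  refine ⟨x * x ^ (m + 1), x ^ (m + 1) * (x ^ (m + 1) * y * x ^ (m + 1)) ^ m, ?_⟩
  conv_lhs => rw [← hpow x, pow_succ', heq, pow_succ']
  simp only [mul_assoc]

/-- If neither `U⁺` nor `U⁻` belongs to `V`, then `V` is closed under dualizing. -/
theorem dual_mem_of_notMem (hV : IsPseudovariety V) (hCR : V ⊆ CR) (hp : Uplus.{u} ∉ V)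
    (hm : Uminus.{u} ∉ V) {S : FinOrdSemigroup.{u}} (hS : S ∈ V) : S.dual ∈ V := by
  obtain ⟨n, hn, hpow⟩ := exists_pow_succ_eq (hCR hS)
  obtain ⟨f, hf⟩ := Countable.exists_injective_nat S
  refine mem_of_inequalities hV (J := S → S) (A := S) (fun _ => S) (fun _ => hS) (fun σ => σ)
    S.dual (fun s => s) (fun s => ⟨s, rfl⟩) ?_
  intro u v huv
  have hholds : Holds S (encode f u) (encode f v) := fun σ => by
    rw [eval_encode, eval_encode, withOneLE_coe]
    exact huv (σ ∘ f)
  have habs : ∀ x y : FreeMonoid ℕ, x ≠ 1 →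
      Holds S x (x * (y * x) ^ n) ∧ Holds S (x * (y * x) ^ n) x := by
    intro x y hx
    have h : ∀ σ : ℕ → S, eval σ (x * (y * x) ^ n) = eval σ x := fun σ => by
      obtain ⟨s, hs⟩ := exists_eval_eq_coe σ hx
      rw [map_mul, map_pow, map_mul]
      exact mul_pow_eq_of_notMem hV hp hm hS hn hpow _ _ (hs ▸ WithOne.coe_ne_one)
    constructor <;> intro σ <;> rw [h σ] <;> exact withOneLE_refl _
  have h := (isInequationalTheory_holds S).symm_of_absorbing hn habs (encode_ne_one f u)
    (encode_ne_one f v) hholds (Function.invFun f)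
  rw [eval_encode, eval_encode, withOneLE_coe, Function.invFun_comp hf] at h
  exact h

/-- One inclusion suffices, because S is the image of its double dual under the identity. -/
theorem isSelfdual_of_dual_mem (hV : IsPseudovariety V) (h : ∀ S ∈ V, S.dual ∈ V) :
    IsSelfdual V := by
  refine Set.Subset.antisymm h fun S hS => ?_
  exact hV.image_mem _ (h _ hS) S ⟨⟨fun s => s, fun _ _ => rfl⟩, fun _ _ h => h, fun s => ⟨s, rfl⟩⟩

theorem IsSelfdual.inter {W : Set FinOrdSemigroup.{u}} (hV : IsSelfdual V) (hW : IsSelfdual W) :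
    IsSelfdual (V ∩ W) := by
  ext S
  exact and_congr (Set.ext_iff.1 hV S) (Set.ext_iff.1 hW S)

theorem isSelfdual_NB : IsSelfdual NB.{u} := Set.ext fun _ => Iff.rfl

theorem isSelfdual_Sl : IsSelfdual Sl.{u} := Set.ext fun _ => Iff.rfl

theorem Sl_subset_NB : Sl.{u} ⊆ NB := fun _ hS =>
  ⟨hS.1, fun x y z => by rw [mul_assoc x y z, hS.2 y z, ← mul_assoc]⟩

theorem Uplus_mem_Sl : Uplus.{u} ∈ Sl :=
  ⟨by rintro (_ | _) <;> rfl, by rintro (_ | _) (_ | _) <;> rfl⟩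

end Pseudovariety

end OrderedCR

/-! ### The equivalence. -/

open OrderedCR FinOrdSemigroup in
theorem theoremt (V : Set FinOrdSemigroup.{u}) (hV : FinOrdSemigroup.IsPseudovariety V)
    (hCR : V ⊆ FinOrdSemigroup.CR) :
    List.TFAE
      [FinOrdSemigroup.IsSelfdual V,
       FinOrdSemigroup.IsSelfdual (V ∩ FinOrdSemigroup.NB),
       FinOrdSemigroup.IsSelfdual (V ∩ FinOrdSemigroup.Sl),
       (FinOrdSemigroup.Uplus ∈ V ∧ FinOrdSemigroup.Uminus ∈ V) ∨
         (FinOrdSemigroup.Uplus ∉ V ∧ FinOrdSemigroup.Uminus ∉ V)] := by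
  tfae_have 1 → 2 := fun h => IsSelfdual.inter h isSelfdual_NB
  tfae_have 2 → 3 := fun h => by
    have h1 := IsSelfdual.inter h isSelfdual_Sl
    rwa [Set.inter_assoc, Set.inter_eq_right.2 Sl_subset_NB] at h1
  tfae_have 3 → 4 := fun h => by
    have h1 : Uplus ∈ V ∩ Sl ↔ Uminus ∈ V ∩ Sl := Set.ext_iff.1 h Uplus
    have h2 : Uminus ∈ Sl := (Set.ext_iff.1 isSelfdual_Sl Uplus).1 Uplus_mem_Sl
    have h3 : Uplus ∈ V ↔ Uminus ∈ V :=
      ⟨fun h => (h1.1 ⟨h, Uplus_mem_Sl⟩).1, fun h => (h1.2 ⟨h, h2⟩).1⟩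
    rw [h3]
    tauto
  tfae_have 4 → 1 := fun h => isSelfdual_of_dual_mem hV fun S hS => by
    rcases h with ⟨hp, hm⟩ | ⟨hp, hm⟩
    · exact dual_mem_of_mem hV hCR hp hm hS
    · exact dual_mem_of_notMem hV hCR hp hm hS
  tfae_finish
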